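/- Let $\mathbb{K}$ be a field. A Leibniz algebra is a $\mathbb{K}$-vector space $\mathfrak{g}$ with a bilinear bracket satisfying $[x,[y,z]]=[[x,y],z]-[[x,z],y]$ for all $x,y,z\in\mathfrak{g}$; its center is the ideal $Z(\mathfrak{g})=\{c\in\mathfrak{g}\mid [x,c]=0=[c,x]\text{ for all }x\in\mathfrak{g}\}$. Call $\mathfrak{g}$ capable if there is a Leibniz algebra $\mathfrak{q}$ with $\mathfrak{g}\cong\mathfrak{q}/Z(\mathfrak{q})$ as Leibniz algebras. Let $\mathfrak{g}\star\mathfrak{g}$ be the non-abelian tensor product of $\mathfrak{g}$ with itself, both actions being given by the bracket, that is, the Leibniz algebra generated by the symbols $x*_1y$ and $x*_2y$ ($x,y\in\mathfrak{g}$) subject to the following relations, for $i=1,2$, $k\in\mathbb{K}$ and $m,m',n,n'\in\mathfrak{g}$: \begin{align*} &k(m*_in)=km*_in=m*_ikn,\quad (m+m')*_in=m*_in+m'*_in,\quad m*_i(n+n')=m*_in+m*_in',\\ &m*_1[n,n']=[m,n]*_1n'-[m,n']*_1n,\qquad [m,m']*_2n=m'*_2[n,m]-m*_2[n,m'],\\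 &[m,m']*_1n=m'*_2[m,n]-m*_1[n,m'],\qquad m*_2[n,n']=[n,m]*_1n'-[m,n']*_2n,\\ &m*_1[m',n]=-m*_1[n,m'],\qquad [n',m]*_2n=-[m,n']*_2n,\\ &[m,n]*_1[m',n']=[m*_1n,m'*_1n']=[m',n']*_2[m,n],\\ &[n,m]*_1[n',m']=[m*_2n,m'*_2n']=[n',m']*_2[n,m],\\ &[m,n]*_1[n',m']=[m*_1n,m'*_2n']=[n',m']*_2[m,n],\\ &[n,m]*_1[m',n']=[m*_2n,m'*_1n']=[m',n']*_2[n,m]. \end{align*} The subspace of $\mathfrak{g}\star\mathfrak{g}$ spanned by all elements $x*_1y-y*_2x$ is an ideal; the non-abelian exterior product $\mathfrak{g}\curlywedge\mathfrak{g}$ is the quotient of $\mathfrak{g}\star\mathfrak{g}$ by this ideal, and $x\curlywedge_iy$ denotes the class of $x*_iy$. The exterior center of $\mathfrak{g}$ is $$Z^{\curlywedge}(\mathfrak{g})=\{g\in\mathfrak{g}\mid g\curlywedge_1x=g\curlywedge_2x=0\text{ for all }x\in\mathfrak{g}\}.$$ Theorem. A Leibniz algebra $\mathfrak{g}$ over $\mathbb{K}$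 is capable if and only if $Z^{\curlywedge}(\mathfrak{g})=0$. -/

import Mathlib

universe u v w

noncomputable section

/-! ### Leibniz algebras -/

/-- The additive part of a (right) Leibniz algebra: an additive group with a biadditive bracket
that satisfies the Leibniz identity. -/
class LeibnizRing (L : Type*) extends AddCommGroup L, Bracket L L where
  add_bracket : ∀ x y z : L, ⁅x + y, z⁆ = ⁅x, z⁆ + ⁅y, z⁆
  bracket_add : ∀ x y z : L, ⁅x, y + z⁆ = ⁅x, y⁆ + ⁅x, z⁆
  leibniz : ∀ x y z : L, ⁅x, ⁅y, z⁆⁆ = ⁅⁅x, y⁆, z⁆ - ⁅⁅x, z⁆, y⁆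

/-- A Leibniz algebra over the field `K`: a `K`-vector space with a `K`-bilinear bracket that
satisfies the Leibniz identity. -/
class LeibnizAlgebra (K L : Type*) [Field K] [LeibnizRing L] extends Module K L where
  smul_bracket : ∀ (k : K) (x y : L), ⁅k • x, y⁆ = k • ⁅x, y⁆
  bracket_smul : ∀ (k : K) (x y : L), ⁅x, k • y⁆ = k • ⁅x, y⁆

/-- Homomorphisms of Leibniz algebras. -/
structure LeibnizHom (K L L' : Type*) [Field K] [LeibnizRing L] [LeibnizAlgebra K L]
    [LeibnizRing L'] [LeibnizAlgebra K L'] extends L →ₗ[K] L' where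
  map_bracket : ∀ x y : L, toFun ⁅x, y⁆ = ⁅toFun x, toFun y⁆

/-- Isomorphisms of Leibniz algebras. -/
structure LeibnizEquiv (K L L' : Type*) [Field K] [LeibnizRing L] [LeibnizAlgebra K L]
    [LeibnizRing L'] [LeibnizAlgebra K L'] extends L ≃ₗ[K] L' where
  map_bracket : ∀ x y : L, toFun ⁅x, y⁆ = ⁅toFun x, toFun y⁆

namespace LeibnizRing

variable {L : Type*} [LeibnizRing L]

theorem zero_bracket (y : L) : ⁅(0 : L), y⁆ = 0 := by
  have h := add_bracket (0 : L) 0 y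
  rw [add_zero] at h
  exact left_eq_add.mp h

theorem bracket_zero (x : L) : ⁅x, (0 : L)⁆ = 0 := by
  have h := bracket_add x (0 : L) 0
  rw [add_zero] at h
  exact left_eq_add.mp h

theorem neg_bracket (x y : L) : ⁅-x, y⁆ = -⁅x, y⁆ := by
  rw [eq_neg_iff_add_eq_zero, ← add_bracket, neg_add_cancel, zero_bracket]

theorem bracket_neg (x y : L) : ⁅x, -y⁆ = -⁅x, y⁆ := by
  rw [eq_neg_iff_add_eq_zero, ← bracket_add, neg_add_cancel, bracket_zero]

theorem sub_bracket (x y z : L) : ⁅x - y, z⁆ = ⁅x, z⁆ - ⁅y, z⁆ := by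
  rw [sub_eq_add_neg, add_bracket, neg_bracket, ← sub_eq_add_neg]

theorem bracket_sub (x y z : L) : ⁅x, y - z⁆ = ⁅x, y⁆ - ⁅x, z⁆ := by
  rw [sub_eq_add_neg, bracket_add, bracket_neg, ← sub_eq_add_neg]

end LeibnizRing

/-! ### Ideals, quotients and the center -/

/-- Two-sided ideals of a Leibniz algebra. -/
structure LeibnizIdeal (K L : Type*) [Field K] [LeibnizRing L] [LeibnizAlgebra K L]
    extends Submodule K L where
  bracket_mem_left : ∀ a x : L, a ∈ carrier → ⁅a, x⁆ ∈ carrier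
  bracket_mem_right : ∀ a x : L, a ∈ carrier → ⁅x, a⁆ ∈ carrier

namespace LeibnizIdeal

variable {K L : Type*} [Field K] [LeibnizRing L] [LeibnizAlgebra K L]

/-- The quotient of a Leibniz algebra by an ideal. -/
def Quotient (I : LeibnizIdeal K L) : Type _ := L ⧸ I.toSubmodule

instance (I : LeibnizIdeal K L) : AddCommGroup I.Quotient :=
  Submodule.Quotient.addCommGroup I.toSubmodule

instance (I : LeibnizIdeal K L) : Module K I.Quotient :=
  Submodule.Quotient.module I.toSubmodule

/-- The quotient map, as a linear map. -/
def mkQ (I : LeibnizIdeal K L) : L →ₗ[K] I.Quotient := I.toSubmodule.mkQ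

theorem mk_surjective (I : LeibnizIdeal K L) : Function.Surjective I.mkQ :=
  I.toSubmodule.mkQ_surjective

theorem mk_eq_mk (I : LeibnizIdeal K L) {x y : L} :
    I.mkQ x = I.mkQ y ↔ x - y ∈ I.toSubmodule :=
  Submodule.Quotient.eq I.toSubmodule

theorem mk_bracket_congr (I : LeibnizIdeal K L) {x x' y y' : L}
    (hx : I.mkQ x = I.mkQ x') (hy : I.mkQ y = I.mkQ y') : I.mkQ ⁅x, y⁆ = I.mkQ ⁅x', y'⁆ := by
  rw [mk_eq_mk] at hx hy ⊢
  have h : ⁅x, y⁆ - ⁅x', y'⁆ = ⁅x - x', y⁆ + ⁅x', y - y'⁆ := by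
    rw [LeibnizRing.sub_bracket, LeibnizRing.bracket_sub]; abel
  rw [h]
  exact I.toSubmodule.add_mem (I.bracket_mem_left _ _ hx) (I.bracket_mem_right _ _ hy)

/-- The bracket of the quotient, `[x + I, y + I] = [x, y] + I`. -/
instance (I : LeibnizIdeal K L) : Bracket I.Quotient I.Quotient where
  bracket a b := Quotient.liftOn₂' a b (fun x y => I.mkQ ⁅x, y⁆) fun _ _ _ _ hx hy =>
    I.mk_bracket_congr (Quotient.sound hx) (Quotient.sound hy)

theorem mk_bracket (I : LeibnizIdeal K L) (x y : L) : I.mkQ ⁅x, y⁆ = ⁅I.mkQ x, I.mkQ y⁆ := rfl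

instance (I : LeibnizIdeal K L) : LeibnizRing I.Quotient where
  add_bracket a b c := by
    obtain ⟨x, rfl⟩ := I.mk_surjective a
    obtain ⟨y, rfl⟩ := I.mk_surjective b
    obtain ⟨z, rfl⟩ := I.mk_surjective c
    rw [← map_add, ← mk_bracket, LeibnizRing.add_bracket, map_add, mk_bracket, mk_bracket]
  bracket_add a b c := by
    obtain ⟨x, rfl⟩ := I.mk_surjective a
    obtain ⟨y, rfl⟩ := I.mk_surjective b
    obtain ⟨z, rfl⟩ := I.mk_surjective c
    rw [← map_add, ← mk_bracket, LeibnizRing.bracket_add, map_add, mk_bracket, mk_bracket]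
  leibniz a b c := by
    obtain ⟨x, rfl⟩ := I.mk_surjective a
    obtain ⟨y, rfl⟩ := I.mk_surjective b
    obtain ⟨z, rfl⟩ := I.mk_surjective c
    simp only [← mk_bracket, ← map_sub]
    rw [LeibnizRing.leibniz]

instance (I : LeibnizIdeal K L) : LeibnizAlgebra K I.Quotient where
  smul_bracket k a b := by
    obtain ⟨x, rfl⟩ := I.mk_surjective a
    obtain ⟨y, rfl⟩ := I.mk_surjective b
    rw [← map_smul, ← mk_bracket, LeibnizAlgebra.smul_bracket, map_smul, mk_bracket]
  bracket_smul k a b := by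
    obtain ⟨x, rfl⟩ := I.mk_surjective a
    obtain ⟨y, rfl⟩ := I.mk_surjective b
    rw [← map_smul, ← mk_bracket, LeibnizAlgebra.bracket_smul, map_smul, mk_bracket]

/-- The ideal generated by a set: the intersection of all ideals that contain it. -/
def generatedBy (K : Type*) {L : Type*} [Field K] [LeibnizRing L] [LeibnizAlgebra K L]
    (S : Set L) : LeibnizIdeal K L where
  toSubmodule := sInf {J | ∃ I : LeibnizIdeal K L, I.toSubmodule = J ∧ S ⊆ J}
  bracket_mem_left a x ha := by
    refine Submodule.mem_sInf.mpr ?_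
    rintro _ ⟨I, rfl, hS⟩
    exact I.bracket_mem_left a x ((Submodule.mem_sInf.mp ha) _ ⟨I, rfl, hS⟩)
  bracket_mem_right a x ha := by
    refine Submodule.mem_sInf.mpr ?_
    rintro _ ⟨I, rfl, hS⟩
    exact I.bracket_mem_right a x ((Submodule.mem_sInf.mp ha) _ ⟨I, rfl, hS⟩)

theorem subset_generatedBy {S : Set L} {x : L} (hx : x ∈ S) :
    x ∈ (generatedBy K S).toSubmodule := by
  refine Submodule.mem_sInf.mpr ?_
  rintro _ ⟨I, rfl, hS⟩
  exact hS hx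

end LeibnizIdeal

/-- The center `Z(L) = {c | [x, c] = 0 = [c, x] for all x}`, as an ideal. -/
def LeibnizAlgebra.center (K L : Type*) [Field K] [LeibnizRing L] [LeibnizAlgebra K L] :
    LeibnizIdeal K L where
  carrier := {c | ∀ x : L, ⁅x, c⁆ = 0 ∧ ⁅c, x⁆ = 0}
  zero_mem' x := ⟨LeibnizRing.bracket_zero x, LeibnizRing.zero_bracket x⟩
  add_mem' {a b} ha hb x := by
    rw [LeibnizRing.bracket_add, LeibnizRing.add_bracket, (ha x).1, (ha x).2, (hb x).1, (hb x).2]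
    exact ⟨add_zero 0, add_zero 0⟩
  smul_mem' k a ha x := by
    rw [LeibnizAlgebra.bracket_smul, LeibnizAlgebra.smul_bracket, (ha x).1, (ha x).2]
    exact ⟨smul_zero k, smul_zero k⟩
  bracket_mem_left a x ha y := by
    rw [(ha x).2]
    exact ⟨LeibnizRing.bracket_zero y, LeibnizRing.zero_bracket y⟩
  bracket_mem_right a x ha y := by
    rw [(ha x).1]
    exact ⟨LeibnizRing.bracket_zero y, LeibnizRing.zero_bracket y⟩

/-- `L` is capable if `L ≅ Q / Z(Q)` for some Leibniz algebra `Q`. The parameter `w` only allows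
`Q` to live in an arbitrarily large universe. -/
def LeibnizAlgebra.IsCapable (K : Type u) (L : Type v) [Field K] [LeibnizRing L]
    [LeibnizAlgebra K L] : Prop :=
  ∃ (Q : Type (max v w)) (_ : LeibnizRing Q) (_ : LeibnizAlgebra K Q),
    Nonempty (LeibnizEquiv K L (LeibnizAlgebra.center K Q).Quotient)

/-! ### Free Leibniz algebras -/

namespace FreeLeibnizAlgebra

/-- The smallest two-sided ideal of the free non-associative algebra on `X` that contains all
elements `x(yz) - ((xy)z - (xz)y)`. -/
def relations (K : Type u) (X : Type v) [Field K] :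
    Submodule K (FreeNonUnitalNonAssocAlgebra K X) :=
  sInf {J | (∀ a x, a ∈ J → a * x ∈ J ∧ x * a ∈ J) ∧
    ∀ x y z, x * (y * z) - ((x * y) * z - (x * z) * y) ∈ J}

theorem relations_mul (K : Type u) (X : Type v) [Field K]
    (a x : FreeNonUnitalNonAssocAlgebra K X) (ha : a ∈ relations K X) :
    a * x ∈ relations K X ∧ x * a ∈ relations K X := by
  constructor <;> refine Submodule.mem_sInf.mpr fun J hJ => ?_
  · exact (hJ.1 a x (Submodule.mem_sInf.mp ha J hJ)).1
  · exact (hJ.1 a x (Submodule.mem_sInf.mp ha J hJ)).2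

theorem relations_leibniz (K : Type u) (X : Type v) [Field K]
    (x y z : FreeNonUnitalNonAssocAlgebra K X) :
    x * (y * z) - ((x * y) * z - (x * z) * y) ∈ relations K X :=
  Submodule.mem_sInf.mpr fun _ hJ => hJ.2 x y z

end FreeLeibnizAlgebra

/-- The free Leibniz algebra on the set `X`. -/
def FreeLeibnizAlgebra (K : Type u) (X : Type v) [Field K] : Type (max u v) :=
  FreeNonUnitalNonAssocAlgebra K X ⧸ FreeLeibnizAlgebra.relations K X

namespace FreeLeibnizAlgebra

variable {K : Type u} {X : Type v} [Field K]

instance : AddCommGroup (FreeLeibnizAlgebra K X) :=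
  Submodule.Quotient.addCommGroup (relations K X)

instance : Module K (FreeLeibnizAlgebra K X) :=
  Submodule.Quotient.module (relations K X)

/-- The quotient map from the free non-associative algebra. -/
def mk : FreeNonUnitalNonAssocAlgebra K X →ₗ[K] FreeLeibnizAlgebra K X := (relations K X).mkQ

/-- The inclusion of the generators. -/
def of (x : X) : FreeLeibnizAlgebra K X := mk (FreeNonUnitalNonAssocAlgebra.of K x)

theorem mk_surjective : Function.Surjective (mk : _ →ₗ[K] FreeLeibnizAlgebra K X) :=
  (relations K X).mkQ_surjective

theorem mk_eq_mk {x y : FreeNonUnitalNonAssocAlgebra K X} :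
    mk x = mk y ↔ x - y ∈ relations K X :=
  Submodule.Quotient.eq (relations K X)

theorem mk_mul_congr {x x' y y' : FreeNonUnitalNonAssocAlgebra K X}
    (hx : mk x = mk x') (hy : mk y = mk y') : mk (x * y) = mk (x' * y') := by
  rw [mk_eq_mk] at hx hy ⊢
  have h : x * y - x' * y' = (x - x') * y + x' * (y - y') := by
    rw [sub_mul, mul_sub]; abel
  rw [h]
  exact (relations K X).add_mem (relations_mul K X _ _ hx).1 (relations_mul K X _ _ hy).2

/-- The bracket is induced by the product of the free non-associative algebra. -/
instance : Bracket (FreeLeibnizAlgebra K X) (FreeLeibnizAlgebra K X) where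
  bracket a b := Quotient.liftOn₂' a b (fun x y => mk (x * y)) fun _ _ _ _ hx hy =>
    mk_mul_congr (Quotient.sound hx) (Quotient.sound hy)

theorem mk_mul (x y : FreeNonUnitalNonAssocAlgebra K X) : mk (x * y) = ⁅mk x, mk y⁆ := rfl

instance : LeibnizRing (FreeLeibnizAlgebra K X) where
  add_bracket a b c := by
    obtain ⟨x, rfl⟩ := mk_surjective a
    obtain ⟨y, rfl⟩ := mk_surjective b
    obtain ⟨z, rfl⟩ := mk_surjective c
    rw [← map_add, ← mk_mul, add_mul, map_add, mk_mul, mk_mul]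
  bracket_add a b c := by
    obtain ⟨x, rfl⟩ := mk_surjective a
    obtain ⟨y, rfl⟩ := mk_surjective b
    obtain ⟨z, rfl⟩ := mk_surjective c
    rw [← map_add, ← mk_mul, mul_add, map_add, mk_mul, mk_mul]
  leibniz a b c := by
    obtain ⟨x, rfl⟩ := mk_surjective a
    obtain ⟨y, rfl⟩ := mk_surjective b
    obtain ⟨z, rfl⟩ := mk_surjective c
    simp only [← mk_mul, ← map_sub]
    exact mk_eq_mk.mpr (relations_leibniz K X x y z)

instance : LeibnizAlgebra K (FreeLeibnizAlgebra K X) where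
  smul_bracket k a b := by
    obtain ⟨x, rfl⟩ := mk_surjective a
    obtain ⟨y, rfl⟩ := mk_surjective b
    rw [← map_smul, ← mk_mul, smul_mul_assoc, map_smul, mk_mul]
  bracket_smul k a b := by
    obtain ⟨x, rfl⟩ := mk_surjective a
    obtain ⟨y, rfl⟩ := mk_surjective b
    rw [← map_smul, ← mk_mul, mul_smul_comm, map_smul, mk_mul]

/-- Induction: the free Leibniz algebra is generated by the elements `of x`. -/
theorem induction {P : FreeLeibnizAlgebra K X → Prop} (h0 : P 0) (hof : ∀ x, P (of x))
    (hadd : ∀ a b, P a → P b → P (a + b)) (hsmul : ∀ (k : K) a, P a → P (k • a))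
    (hbr : ∀ a b, P a → P b → P ⁅a, b⁆) (a : FreeLeibnizAlgebra K X) : P a := by
  obtain ⟨x, rfl⟩ := mk_surjective a
  have hm : ∀ m : FreeMagma X, P (mk (MonoidAlgebra.single m (1 : K))) := by
    intro m
    induction m with
    | ih1 x => exact hof x
    | ih2 m n hm hn =>
      have h : MonoidAlgebra.single (m * n) (1 : K) =
          (MonoidAlgebra.single m 1 * MonoidAlgebra.single n 1 :
            FreeNonUnitalNonAssocAlgebra K X) := by
        refine Eq.symm ((MonoidAlgebra.single_mul_single ..).trans ?_)
        rw [one_mul]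
      rw [h, mk_mul]
      exact hbr _ _ hm hn
  refine MonoidAlgebra.induction_linear (motive := fun x => P (mk x)) x ?_ ?_ ?_
  · exact (map_zero (mk (K := K) (X := X))).symm ▸ h0
  · intro f g hf hg
    have h := hadd _ _ hf hg
    rwa [← map_add] at h
  · intro m k
    have h := hsmul k _ (hm m)
    rw [← map_smul] at h
    have h' : k • (MonoidAlgebra.single m (1 : K) : FreeNonUnitalNonAssocAlgebra K X)
        = MonoidAlgebra.single m k := by
      refine (MonoidAlgebra.smul_single ..).trans ?_
      rw [smul_eq_mul, mul_one]
    rwa [h'] at h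

end FreeLeibnizAlgebra

/-! ### Actions and crossed modules -/

/-- A Leibniz action of `M` on `N`; `left m n` is `ᵐn` and `right n m` is `nᵐ`. -/
structure LeibnizAction (K M N : Type*) [Field K] [LeibnizRing M] [LeibnizAlgebra K M]
    [LeibnizRing N] [LeibnizAlgebra K N] where
  left : M →ₗ[K] N →ₗ[K] N
  right : N →ₗ[K] M →ₗ[K] N
  left_bracket : ∀ (m m' : M) (n : N), left ⁅m, m'⁆ n = left m (left m' n) + right (left m n) m'
  right_bracket : ∀ (m m' : M) (n : N), right n ⁅m, m'⁆ = right (right n m) m' - right (right n m') m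
  left_left : ∀ (m m' : M) (n : N), left m (left m' n) = -left m (right n m')
  bracket_left : ∀ (m : M) (n n' : N), left m ⁅n, n'⁆ = ⁅left m n, n'⁆ - ⁅left m n', n⁆
  bracket_right : ∀ (m : M) (n n' : N), right ⁅n, n'⁆ m = ⁅right n m, n'⁆ + ⁅n, right n' m⁆
  bracket_left_right : ∀ (m : M) (n n' : N), ⁅n, left m n'⁆ = -⁅n, right n' m⁆

/-- A Leibniz crossed module `η : M → G`. -/
structure LeibnizCrossedModule (K M G : Type*) [Field K] [LeibnizRing M] [LeibnizAlgebra K M]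
    [LeibnizRing G] [LeibnizAlgebra K G] where
  η : LeibnizHom K M G
  action : LeibnizAction K G M
  map_left : ∀ x m, η.toFun (action.left x m) = ⁅x, η.toFun m⁆
  map_right : ∀ x m, η.toFun (action.right m x) = ⁅η.toFun m, x⁆
  left_map : ∀ m m', action.left (η.toFun m) m' = ⁅m, m'⁆
  right_map : ∀ m m', action.right m (η.toFun m') = ⁅m, m'⁆

/-- The action of `M` on `N` obtained from an action of `G` on `N` along `f : M → G`. -/
def LeibnizAction.comp {K M N G : Type*} [Field K] [LeibnizRing M] [LeibnizAlgebra K M]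
    [LeibnizRing N] [LeibnizAlgebra K N] [LeibnizRing G] [LeibnizAlgebra K G]
    (α : LeibnizAction K G N) (f : LeibnizHom K M G) : LeibnizAction K M N where
  left := α.left.comp f.toLinearMap
  right := α.right.compl₂ f.toLinearMap
  left_bracket m m' n := by
    have h := f.map_bracket m m'
    exact (congrArg (fun g => α.left g n) h).trans (α.left_bracket _ _ _)
  right_bracket m m' n := by
    have h := f.map_bracket m m'
    exact (congrArg (fun g => α.right n g) h).trans (α.right_bracket _ _ _)
  left_left _ _ _ := α.left_left _ _ _
  bracket_left _ _ _ := α.bracket_left _ _ _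
  bracket_right _ _ _ := α.bracket_right _ _ _
  bracket_left_right _ _ _ := α.bracket_left_right _ _ _

/-- A Leibniz algebra acts on itself by its bracket: `ᵐn = [m, n]` and `nᵐ = [n, m]`. -/
def LeibnizAction.adjoint (K L : Type*) [Field K] [LeibnizRing L] [LeibnizAlgebra K L] :
    LeibnizAction K L L where
  left := LinearMap.mk₂ K (fun x y => ⁅x, y⁆) LeibnizRing.add_bracket
    LeibnizAlgebra.smul_bracket LeibnizRing.bracket_add LeibnizAlgebra.bracket_smul
  right := LinearMap.mk₂ K (fun x y => ⁅x, y⁆) LeibnizRing.add_bracket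
    LeibnizAlgebra.smul_bracket LeibnizRing.bracket_add LeibnizAlgebra.bracket_smul
  left_bracket m m' n := by
    simp only [LinearMap.mk₂_apply]
    rw [LeibnizRing.leibniz m m' n]; abel
  right_bracket m m' n := LeibnizRing.leibniz n m m'
  left_left m m' n := by
    simp only [LinearMap.mk₂_apply]
    rw [LeibnizRing.leibniz, LeibnizRing.leibniz m n m']; abel
  bracket_left m n n' := LeibnizRing.leibniz m n n'
  bracket_right m n n' := by
    simp only [LinearMap.mk₂_apply]
    rw [LeibnizRing.leibniz n n' m]; abel
  bracket_left_right m n n' := by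
    simp only [LinearMap.mk₂_apply]
    rw [LeibnizRing.leibniz, LeibnizRing.leibniz n n' m]; abel

/-- A Leibniz algebra as a crossed module over itself by the identity map. -/
def LeibnizCrossedModule.id (K L : Type*) [Field K] [LeibnizRing L] [LeibnizAlgebra K L] :
    LeibnizCrossedModule K L L where
  η := { LinearMap.id with map_bracket := fun _ _ => rfl }
  action := LeibnizAction.adjoint K L
  map_left _ _ := rfl
  map_right _ _ := rfl
  left_map _ _ := rfl
  right_map _ _ := rfl

/-! ### The non-abelian tensor product -/

namespace LeibnizTensor

/-- The generating symbols: `(m, n)` on the left for `m *₁ n`, on the right for `m *₂ n`. -/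
abbrev Symbols (M : Type*) (N : Type*) : Type _ := (M × N) ⊕ (M × N)

section

variable {K M N : Type*} [Field K] [LeibnizRing M] [LeibnizAlgebra K M]
  [LeibnizRing N] [LeibnizAlgebra K N]

/-- The symbol `m *₁ n` in the free Leibniz algebra. -/
def s₁ (K : Type*) {M N : Type*} [Field K] (m : M) (n : N) :
    FreeLeibnizAlgebra K (Symbols M N) :=
  FreeLeibnizAlgebra.of (Sum.inl (m, n))

/-- The symbol `m *₂ n` in the free Leibniz algebra. -/
def s₂ (K : Type*) {M N : Type*} [Field K] (m : M) (n : N) :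
    FreeLeibnizAlgebra K (Symbols M N) :=
  FreeLeibnizAlgebra.of (Sum.inr (m, n))

/-- `Rel α β a b` says that `a = b` is one of the defining relations of the non-abelian tensor
product of `M` and `N`, where `α` is the action of `M` on `N` and `β` that of `N` on `M`. -/
inductive Rel (α : LeibnizAction K M N) (β : LeibnizAction K N M) :
    FreeLeibnizAlgebra K (Symbols M N) → FreeLeibnizAlgebra K (Symbols M N) → Prop
  | smul_left₁ (k : K) (m : M) (n : N) : Rel α β (k • s₁ K m n) (s₁ K (k • m) n)
  | smul_right₁ (k : K) (m : M) (n : N) : Rel α β (k • s₁ K m n) (s₁ K m (k • n))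
  | smul_left₂ (k : K) (m : M) (n : N) : Rel α β (k • s₂ K m n) (s₂ K (k • m) n)
  | smul_right₂ (k : K) (m : M) (n : N) : Rel α β (k • s₂ K m n) (s₂ K m (k • n))
  | add_left₁ (m m' : M) (n : N) : Rel α β (s₁ K (m + m') n) (s₁ K m n + s₁ K m' n)
  | add_left₂ (m m' : M) (n : N) : Rel α β (s₂ K (m + m') n) (s₂ K m n + s₂ K m' n)
  | add_right₁ (m : M) (n n' : N) : Rel α β (s₁ K m (n + n')) (s₁ K m n + s₁ K m n')
  | add_right₂ (m : M) (n n' : N) : Rel α β (s₂ K m (n + n')) (s₂ K m n + s₂ K m n')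
  | rel3a (m : M) (n n' : N) :
      Rel α β (s₁ K m ⁅n, n'⁆) (s₁ K (β.right m n) n' - s₁ K (β.right m n') n)
  | rel3b (m m' : M) (n : N) :
      Rel α β (s₂ K ⁅m, m'⁆ n) (s₂ K m' (α.right n m) - s₂ K m (α.right n m'))
  | rel3c (m m' : M) (n : N) :
      Rel α β (s₁ K ⁅m, m'⁆ n) (s₂ K m' (α.left m n) - s₁ K m (α.right n m'))
  | rel3d (m : M) (n n' : N) :
      Rel α β (s₂ K m ⁅n, n'⁆) (s₁ K (β.left n m) n' - s₂ K (β.right m n') n)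
  | rel4a (m m' : M) (n : N) : Rel α β (s₁ K m (α.left m' n)) (-s₁ K m (α.right n m'))
  | rel4b (m : M) (n n' : N) : Rel α β (s₂ K (β.left n' m) n) (-s₂ K (β.right m n') n)
  | rel5a (m m' : M) (n n' : N) :
      Rel α β (s₁ K (β.right m n) (α.left m' n')) ⁅s₁ K m n, s₁ K m' n'⁆
  | rel5a' (m m' : M) (n n' : N) :
      Rel α β ⁅s₁ K m n, s₁ K m' n'⁆ (s₂ K (β.right m' n') (α.left m n))
  | rel5b (m m' : M) (n n' : N) :
      Rel α β (s₁ K (β.left n m) (α.right n' m')) ⁅s₂ K m n, s₂ K m' n'⁆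
  | rel5b' (m m' : M) (n n' : N) :
      Rel α β ⁅s₂ K m n, s₂ K m' n'⁆ (s₂ K (β.left n' m') (α.right n m))
  | rel5c (m m' : M) (n n' : N) :
      Rel α β (s₁ K (β.right m n) (α.right n' m')) ⁅s₁ K m n, s₂ K m' n'⁆
  | rel5c' (m m' : M) (n n' : N) :
      Rel α β ⁅s₁ K m n, s₂ K m' n'⁆ (s₂ K (β.left n' m') (α.left m n))
  | rel5d (m m' : M) (n n' : N) :
      Rel α β (s₁ K (β.left n m) (α.left m' n')) ⁅s₂ K m n, s₁ K m' n'⁆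
  | rel5d' (m m' : M) (n n' : N) :
      Rel α β ⁅s₂ K m n, s₁ K m' n'⁆ (s₂ K (β.right m' n') (α.right n m))

/-- The ideal of the free Leibniz algebra generated by the defining relations. -/
def relIdeal (α : LeibnizAction K M N) (β : LeibnizAction K N M) :
    LeibnizIdeal K (FreeLeibnizAlgebra K (Symbols M N)) :=
  LeibnizIdeal.generatedBy K {c | ∃ a b, Rel α β a b ∧ c = a - b}

/-- The non-abelian tensor product `M ⋆ N` of two Leibniz algebras acting on each other: the
Leibniz algebra generated by the symbols subject to the defining relations. -/
abbrev Product (α : LeibnizAction K M N) (β : LeibnizAction K N M) : Type _ :=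
  (relIdeal α β).Quotient

/-- The element `m *₁ n` of `M ⋆ N`. -/
def t₁ (α : LeibnizAction K M N) (β : LeibnizAction K N M) (m : M) (n : N) : Product α β :=
  (relIdeal α β).mkQ (s₁ K m n)

/-- The element `m *₂ n` of `M ⋆ N`. -/
def t₂ (α : LeibnizAction K M N) (β : LeibnizAction K N M) (m : M) (n : N) : Product α β :=
  (relIdeal α β).mkQ (s₂ K m n)

theorem mk_eq_of_rel {α : LeibnizAction K M N} {β : LeibnizAction K N M}
    {a b : FreeLeibnizAlgebra K (Symbols M N)} (h : Rel α β a b) :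
    (relIdeal α β).mkQ a = (relIdeal α β).mkQ b :=
  ((relIdeal α β).mk_eq_mk).mpr (LeibnizIdeal.subset_generatedBy ⟨a, b, h, rfl⟩)

end

end LeibnizTensor

/-! ### The non-abelian exterior product and the exterior center -/

namespace LeibnizExterior

open LeibnizTensor

section

variable {K M N G : Type*} [Field K] [LeibnizRing M] [LeibnizAlgebra K M]
  [LeibnizRing N] [LeibnizAlgebra K N] [LeibnizRing G] [LeibnizAlgebra K G]

/-- The tensor product `M ⋆ N` of two crossed modules over `G`, for the actions of `M` and `N` on
each other through `G`. -/
abbrev Tensor (E : LeibnizCrossedModule K M G) (F : LeibnizCrossedModule K N G) : Type _ :=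
  Product (F.action.comp E.η) (E.action.comp F.η)

/-- The elements `m *₁ n' - m' *₂ n` with `η m = μ n` and `η m' = μ n'`. -/
def squareSet (E : LeibnizCrossedModule K M G) (F : LeibnizCrossedModule K N G) :
    Set (Tensor E F) :=
  {c | ∃ (m m' : M) (n n' : N), E.η.toFun m = F.η.toFun n ∧ E.η.toFun m' = F.η.toFun n' ∧
    c = t₁ (F.action.comp E.η) (E.action.comp F.η) m n'
      - t₂ (F.action.comp E.η) (E.action.comp F.η) m' n}

theorem squareSet_bracket (E : LeibnizCrossedModule K M G) (F : LeibnizCrossedModule K N G)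
    {c : Tensor E F} (hc : c ∈ squareSet E F) (y : Tensor E F) : ⁅c, y⁆ = 0 ∧ ⁅y, c⁆ = 0 := by
  obtain ⟨m, m', n, n', h, h', rfl⟩ := hc
  set α := F.action.comp E.η with hα
  set β := E.action.comp F.η with hβ
  have e1 : β.right m n' = β.left n m' := by
    change E.action.right m (F.η.toFun n') = E.action.left (F.η.toFun n) m'
    rw [← h, ← h', E.right_map, E.left_map]
  have e2 : α.left m n' = α.right n m' := by
    change F.action.left (E.η.toFun m) n' = F.action.right n (E.η.toFun m')
    rw [h, h', F.right_map, F.left_map]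
  obtain ⟨y, rfl⟩ := (relIdeal α β).mk_surjective y
  induction y using FreeLeibnizAlgebra.induction with
  | h0 =>
    rw [map_zero]
    exact ⟨LeibnizRing.bracket_zero _, LeibnizRing.zero_bracket _⟩
  | hof x =>
    rw [LeibnizRing.sub_bracket, LeibnizRing.bracket_sub, sub_eq_zero, sub_eq_zero]
    rcases x with ⟨p, q⟩ | ⟨p, q⟩
    · constructor
      · refine (mk_eq_of_rel (Rel.rel5a m p n' q)).symm.trans ?_
        rw [e1]
        exact mk_eq_of_rel (Rel.rel5d m' p n q)
      · refine (mk_eq_of_rel (Rel.rel5a p m q n')).symm.trans ?_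
        rw [e2]
        exact mk_eq_of_rel (Rel.rel5c p m' q n)
    · constructor
      · refine (mk_eq_of_rel (Rel.rel5c m p n' q)).symm.trans ?_
        rw [e1]
        exact mk_eq_of_rel (Rel.rel5b m' p n q)
      · refine (mk_eq_of_rel (Rel.rel5d p m q n')).symm.trans ?_
        rw [e2]
        exact mk_eq_of_rel (Rel.rel5b p m' q n)
  | hadd a b ha hb =>
    rw [map_add, LeibnizRing.bracket_add, LeibnizRing.add_bracket, ha.1, ha.2, hb.1, hb.2]
    exact ⟨add_zero 0, add_zero 0⟩
  | hsmul k a ha =>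
    rw [map_smul, LeibnizAlgebra.bracket_smul, LeibnizAlgebra.smul_bracket, ha.1, ha.2]
    exact ⟨smul_zero k, smul_zero k⟩
  | hbr a b ha hb =>
    rw [LeibnizIdeal.mk_bracket]
    constructor
    · rw [LeibnizRing.leibniz, ha.1, hb.1, LeibnizRing.zero_bracket, LeibnizRing.zero_bracket,
        sub_zero]
    · have hl := LeibnizRing.leibniz ((relIdeal α β).mkQ a) ((relIdeal α β).mkQ b)
        (t₁ α β m n' - t₂ α β m' n)
      rw [hb.2, ha.2, LeibnizRing.bracket_zero, LeibnizRing.zero_bracket, sub_zero] at hl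
      exact hl.symm

/-- The subspace `M □ N` of `M ⋆ N` spanned by the elements `m *₁ n' - m' *₂ n` with `η m = μ n`
and `η m' = μ n'`; it is an ideal. -/
def square (E : LeibnizCrossedModule K M G) (F : LeibnizCrossedModule K N G) :
    LeibnizIdeal K (Tensor E F) where
  toSubmodule := Submodule.span K (squareSet E F)
  bracket_mem_left a x ha := by
    have h : Submodule.span K (squareSet E F)
        ≤ (LeibnizAlgebra.center K (Tensor E F)).toSubmodule :=
      Submodule.span_le.mpr fun c hc y =>
        ⟨(squareSet_bracket E F hc y).2, (squareSet_bracket E F hc y).1⟩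
    rw [((h ha) x).2]
    exact (Submodule.span K (squareSet E F)).zero_mem
  bracket_mem_right a x ha := by
    have h : Submodule.span K (squareSet E F)
        ≤ (LeibnizAlgebra.center K (Tensor E F)).toSubmodule :=
      Submodule.span_le.mpr fun c hc y =>
        ⟨(squareSet_bracket E F hc y).2, (squareSet_bracket E F hc y).1⟩
    rw [((h ha) x).1]
    exact (Submodule.span K (squareSet E F)).zero_mem

/-- The non-abelian exterior product `M ⋏ N = (M ⋆ N) / (M □ N)` of two crossed modules. -/
abbrev Product (E : LeibnizCrossedModule K M G) (F : LeibnizCrossedModule K N G) : Type _ :=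
  (square E F).Quotient

/-- The element `m ⋏₁ n` of `M ⋏ N`. -/
def e₁ (E : LeibnizCrossedModule K M G) (F : LeibnizCrossedModule K N G) (m : M) (n : N) :
    Product E F :=
  (square E F).mkQ (t₁ (F.action.comp E.η) (E.action.comp F.η) m n)

/-- The element `m ⋏₂ n` of `M ⋏ N`. -/
def e₂ (E : LeibnizCrossedModule K M G) (F : LeibnizCrossedModule K N G) (m : M) (n : N) :
    Product E F :=
  (square E F).mkQ (t₂ (F.action.comp E.η) (E.action.comp F.η) m n)

end

end LeibnizExterior

/-- The exterior center of `L`: all `g` such that `g ⋏₁ x = 0` and `g ⋏₂ x = 0` in `L ⋏ L` for all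
`x` in `L`, where `L` is regarded as a crossed module over itself by the identity map. -/
def LeibnizAlgebra.exteriorCenter (K L : Type*) [Field K] [LeibnizRing L] [LeibnizAlgebra K L] :
    Set L :=
  {g | ∀ x : L,
    LeibnizExterior.e₁ (LeibnizCrossedModule.id K L) (LeibnizCrossedModule.id K L) g x = 0 ∧
    LeibnizExterior.e₂ (LeibnizCrossedModule.id K L) (LeibnizCrossedModule.id K L) g x = 0}

end

noncomputable section

/-! Capability is a question about central extensions, and the exterior product is tested against
them through `2`-cocycles. If `L ≅ Q / Z(Q)` with projection `π`, the bracket of `Q` depends only on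
images in `L`, so by `LeibnizExterior.exists_lift` it factors through `L ⋏ L`: `π a ⋏₁ π b ↦ [a, b]`
and `π a ⋏₂ π b ↦ [b, a]`. When `π a` lies in the exterior center, `a` therefore commutes with
everything, so `a ∈ Z(Q)` and `π a = 0`. Conversely, a cocycle `f` gives a central extension `L ×
A`. Its center is exactly `0 × A` as soon as no nonzero central `g` of `L` satisfies `f g x = 0 = f
x g` for all `x` (`IsLeibnizCocycle.isCapable`). The universal cocycle, with values in `L ⊗ L`
modulo boundaries, has this property: where it vanishes every cocycle vanishes, in particular `(x,
y) ↦ x ⋏₁ y`. As `x ⋏₁ g = g ⋏₂ x`, such a `g` lies in the exterior center, which is zero. -/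

/-! ### Lifting maps to Leibniz algebras -/

/-- A Leibniz ring is a non-associative ring whose product is the bracket. -/
abbrev LeibnizRing.toNonUnitalNonAssocRing (L : Type*) [LeibnizRing L] :
    NonUnitalNonAssocRing L where
  mul x y := ⁅x, y⁆
  left_distrib := LeibnizRing.bracket_add
  right_distrib := LeibnizRing.add_bracket
  zero_mul := LeibnizRing.zero_bracket
  mul_zero := LeibnizRing.bracket_zero

/-- A map from a set to a Leibniz algebra extends to the free Leibniz algebra on that set. -/
theorem FreeLeibnizAlgebra.exists_lift {K X Q : Type*} [Field K] [LeibnizRing Q]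
    [LeibnizAlgebra K Q] (f : X → Q) :
    ∃ φ : FreeLeibnizAlgebra K X →ₗ[K] Q,
      (∀ x, φ (of x) = f x) ∧ ∀ a b, φ ⁅a, b⁆ = ⁅φ a, φ b⁆ := by
  let _ := LeibnizRing.toNonUnitalNonAssocRing Q
  have : IsScalarTower K Q Q := ⟨LeibnizAlgebra.smul_bracket⟩
  have : SMulCommClass K Q Q := ⟨fun k x y => (LeibnizAlgebra.bracket_smul k x y).symm⟩
  let g : FreeNonUnitalNonAssocAlgebra K X →ₙₐ[K] Q := FreeNonUnitalNonAssocAlgebra.lift K f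
  have hg : ∀ x y, g (x * y) = ⁅g x, g y⁆ := fun x y => map_mul g x y
  let g' : FreeNonUnitalNonAssocAlgebra K X →ₗ[K] Q :=
    { toFun := g, map_add' := map_add g, map_smul' := map_smul g }
  have hker : relations K X ≤ LinearMap.ker g' := by
    -- `relations` is an infimum, so it suffices that the kernel is itself a two-sided ideal
    -- containing the Leibniz elements.
    refine sInf_le ⟨fun a x ha => ?_, fun x y z => ?_⟩
    · have ha' : g a = 0 := ha
      constructor
      · change g (a * x) = 0
        rw [hg, ha', LeibnizRing.zero_bracket]
      · change g (x * a) = 0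
        rw [hg, ha', LeibnizRing.bracket_zero]
    · change g _ = 0
      rw [map_sub, map_sub]
      simp only [hg]
      rw [LeibnizRing.leibniz, sub_self]
  refine ⟨(relations K X).liftQ g' hker, fun x => ?_, fun a b => ?_⟩
  · exact FreeNonUnitalNonAssocAlgebra.lift_of_apply K f x
  · obtain ⟨x, rfl⟩ := mk_surjective a
    obtain ⟨y, rfl⟩ := mk_surjective b
    exact hg x y

open LeibnizTensor LeibnizExterior in
/-- A central extension `π : Q → L` induces a map `L ⋏ L → Q` that sends `π a ⋏₁ π b` to `[a, b]`
and `π a ⋏₂ π b` to `[b, a]`. -/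
theorem LeibnizExterior.exists_lift {K L Q : Type*} [Field K] [LeibnizRing L] [LeibnizAlgebra K L]
    [LeibnizRing Q] [LeibnizAlgebra K Q] (π : LeibnizHom K Q L)
    (hπ : Function.Surjective π.toLinearMap)
    (hker : LinearMap.ker π.toLinearMap ≤ (LeibnizAlgebra.center K Q).toSubmodule) :
    ∃ ψ : Product (LeibnizCrossedModule.id K L) (LeibnizCrossedModule.id K L) →ₗ[K] Q,
      ∀ a b : Q, ψ (e₁ _ _ (π.toLinearMap a) (π.toLinearMap b)) = ⁅a, b⁆ ∧
        ψ (e₂ _ _ (π.toLinearMap a) (π.toLinearMap b)) = ⁅b, a⁆ := by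
  obtain ⟨p, hpb⟩ := π
  change Function.Surjective p at hπ
  change LinearMap.ker p ≤ _ at hker
  change ∀ x y, p ⁅x, y⁆ = ⁅p x, p y⁆ at hpb
  change ∃ ψ : Product (LeibnizCrossedModule.id K L) (LeibnizCrossedModule.id K L) →ₗ[K] Q,
    ∀ a b : Q, ψ (e₁ _ _ (p a) (p b)) = ⁅a, b⁆ ∧ ψ (e₂ _ _ (p a) (p b)) = ⁅b, a⁆
  -- The only use of centrality: changing either argument by an element of the kernel does not
  -- affect the bracket.
  have hcongr : ∀ {a a' b b' : Q}, p a = p a' → p b = p b' → ⁅a, b⁆ = ⁅a', b'⁆ := by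
    intro a a' b b' ha hb
    have h1 : a - a' ∈ (LeibnizAlgebra.center K Q).toSubmodule := hker (by simp [ha])
    have h2 : b - b' ∈ (LeibnizAlgebra.center K Q).toSubmodule := hker (by simp [hb])
    have h3 := (h1 b).2
    have h4 := (h2 a').1
    rw [LeibnizRing.sub_bracket, sub_eq_zero] at h3
    rw [LeibnizRing.bracket_sub, sub_eq_zero] at h4
    rw [h3, h4]
  -- A set-theoretic section is enough: by `hcongr` the values on symbols do not depend on it, so
  -- `h₁` and `h₂` hold for arbitrary preimages and linearity of `s` is never needed.
  let s := Function.surjInv hπ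
  have hs : ∀ x, p (s x) = x := Function.surjInv_eq hπ
  obtain ⟨φ, hφ, hbr⟩ := FreeLeibnizAlgebra.exists_lift (K := K) (X := Symbols L L) (Q := Q)
    (Sum.elim (fun x => ⁅s x.1, s x.2⁆) (fun x => ⁅s x.2, s x.1⁆))
  have h₁ : ∀ a b, φ (s₁ K (p a) (p b)) = ⁅a, b⁆ := fun a b =>
    (hφ _).trans (hcongr (hs _) (hs _))
  have h₂ : ∀ a b, φ (s₂ K (p a) (p b)) = ⁅b, a⁆ := fun a b =>
    (hφ _).trans (hcongr (hs _) (hs _))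
  set E := LeibnizCrossedModule.id K L
  have hl : ∀ x y : L, (E.action.comp E.η).left x y = ⁅x, y⁆ := fun _ _ => rfl
  have hr : ∀ x y : L, (E.action.comp E.η).right x y = ⁅x, y⁆ := fun _ _ => rfl
  -- Once all arguments are lifted to `Q`, both actions are brackets and each relation becomes
  -- bilinearity or a form of the Leibniz identity.
  have hrel : ∀ a b, Rel (E.action.comp E.η) (E.action.comp E.η) a b → φ a = φ b := by
    intro a b h
    cases h
    case smul_left₁ k m n | smul_right₁ k m n | smul_left₂ k m n | smul_right₂ k m n =>
      obtain ⟨m, rfl⟩ := hπ m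
      obtain ⟨n, rfl⟩ := hπ n
      simp only [map_smul φ, ← map_smul p, h₁, h₂, LeibnizAlgebra.smul_bracket,
        LeibnizAlgebra.bracket_smul]
    case add_left₁ m m' n | add_left₂ m m' n | rel3b m m' n | rel3c m m' n | rel4a m m' n
        | add_right₁ m m' n | add_right₂ m m' n | rel3a m m' n | rel3d m m' n | rel4b m m' n =>
      obtain ⟨m, rfl⟩ := hπ m
      obtain ⟨m', rfl⟩ := hπ m'
      obtain ⟨n, rfl⟩ := hπ n
      simp only [hl, hr, ← hpb, ← map_add p, map_add φ, map_sub φ, map_neg φ, h₁, h₂,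
        LeibnizRing.add_bracket, LeibnizRing.bracket_add, LeibnizRing.leibniz] <;>
      abel
    -- The remaining relations involve a bracket of two symbols; both sides become the same bracket
    -- of two brackets in `Q`.
    all_goals
      rename_i m m' n n'
      obtain ⟨m, rfl⟩ := hπ m
      obtain ⟨m', rfl⟩ := hπ m'
      obtain ⟨n, rfl⟩ := hπ n
      obtain ⟨n', rfl⟩ := hπ n'
      simp only [hl, hr, ← hpb, hbr, h₁, h₂]
  let I : LeibnizIdeal K (FreeLeibnizAlgebra K (Symbols L L)) :=
    { toSubmodule := LinearMap.ker φ
      bracket_mem_left := fun a x ha => by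
        change φ a = 0 at ha
        change φ _ = 0
        rw [hbr, ha, LeibnizRing.zero_bracket]
      bracket_mem_right := fun a x ha => by
        change φ a = 0 at ha
        change φ _ = 0
        rw [hbr, ha, LeibnizRing.bracket_zero] }
  have hI : (relIdeal (E.action.comp E.η) (E.action.comp E.η)).toSubmodule ≤ LinearMap.ker φ := by
    refine sInf_le ⟨I, rfl, ?_⟩
    rintro _ ⟨a, b, h, rfl⟩
    change φ (a - b) = 0
    rw [map_sub, hrel a b h, sub_self]
  let χ : Tensor E E →ₗ[K] Q := Submodule.liftQ _ φ hI
  have hχ : (square E E).toSubmodule ≤ LinearMap.ker χ := by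
    refine Submodule.span_le.mpr ?_
    rintro _ ⟨m, m', n, n', h, h', rfl⟩
    change m = n at h
    change m' = n' at h'
    -- Both structure maps are the identity, so a generator is `m *₁ m' - m' *₂ m`, and both terms
    -- go to the same bracket.
    subst h h'
    obtain ⟨m, rfl⟩ := hπ m
    obtain ⟨m', rfl⟩ := hπ m'
    rw [SetLike.mem_coe, LinearMap.mem_ker, map_sub, sub_eq_zero]
    exact (h₁ m m').trans (h₂ m' m).symm
  exact ⟨Submodule.liftQ _ χ hχ, fun a b => ⟨h₁ a b, h₂ a b⟩⟩

/-! ### Central extensions by cocycles -/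

section Cocycle

variable {K L A : Type*} [Field K] [LeibnizRing L] [LeibnizAlgebra K L] [AddCommGroup A]
  [Module K A]

/-- The `2`-cocycle condition with values in a trivial module. -/
def IsLeibnizCocycle (f : L →ₗ[K] L →ₗ[K] A) : Prop :=
  ∀ x y z : L, f x ⁅y, z⁆ = f ⁅x, y⁆ z - f ⁅x, z⁆ y

/-- The bracket `[(x, a), (y, b)] = ([x, y], f x y)` on `L × A`. -/
abbrev IsLeibnizCocycle.leibnizRing {f : L →ₗ[K] L →ₗ[K] A} (hf : IsLeibnizCocycle f) :
    LeibnizRing (L × A) where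
  bracket p q := (⁅p.1, q.1⁆, f p.1 q.1)
  add_bracket p q r := Prod.ext (LeibnizRing.add_bracket _ _ _) (by simp)
  bracket_add p q r := Prod.ext (LeibnizRing.bracket_add _ _ _) (by simp)
  leibniz p q r := Prod.ext (LeibnizRing.leibniz _ _ _) (hf _ _ _)

/-- The central extension of `L` by `A` that is given by a cocycle. -/
abbrev IsLeibnizCocycle.leibnizAlgebra {f : L →ₗ[K] L →ₗ[K] A} (hf : IsLeibnizCocycle f) :
    @LeibnizAlgebra K (L × A) _ hf.leibnizRing :=
  let _ := hf.leibnizRing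
  { (inferInstance : Module K (L × A)) with
    smul_bracket := fun k p q => Prod.ext (LeibnizAlgebra.smul_bracket k p.1 q.1)
      (by change f (k • p.1) q.1 = k • f p.1 q.1; simp)
    bracket_smul := fun k p q => Prod.ext (LeibnizAlgebra.bracket_smul k p.1 q.1)
      (by change f p.1 (k • q.1) = k • f p.1 q.1; simp) }

/-- A Leibniz algebra is capable if it has a cocycle that, together with the bracket, detects every
nonzero element. -/
theorem IsLeibnizCocycle.isCapable {K : Type u} {L : Type v} {A : Type (max v w)} [Field K]
    [LeibnizRing L] [LeibnizAlgebra K L] [AddCommGroup A] [Module K A]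
    {f : L →ₗ[K] L →ₗ[K] A} (hf : IsLeibnizCocycle f)
    (h : ∀ g : L, (∀ x, ⁅g, x⁆ = 0 ∧ ⁅x, g⁆ = 0 ∧ f g x = 0 ∧ f x g = 0) → g = 0) :
    LeibnizAlgebra.IsCapable.{u, v, w} K L := by
  let _ := hf.leibnizRing
  let _ := hf.leibnizAlgebra
  refine ⟨L × A, hf.leibnizRing, hf.leibnizAlgebra, ?_⟩
  let Z := LeibnizAlgebra.center K (L × A)
  let π : (L × A) →ₗ[K] L :=
    { toFun := Prod.fst, map_add' := fun _ _ => rfl, map_smul' := fun _ _ => rfl }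
  -- Elements of `0 × A` are always central; conversely, testing a central `p` against the pairs
  -- `(x, 0)` gives exactly the hypotheses of `h` for `p.1`.
  have hZ : Z.toSubmodule = LinearMap.ker π := by
    ext p
    constructor
    · intro hp
      refine h p.1 fun x => ?_
      have h1 := (hp (x, 0)).1
      have h2 := (hp (x, 0)).2
      exact ⟨congrArg Prod.fst h2, congrArg Prod.fst h1, congrArg Prod.snd h2,
        congrArg Prod.snd h1⟩
    · intro hp x
      have hp' : p.1 = 0 := hp
      constructor
      · change (⁅x.1, p.1⁆, f x.1 p.1) = 0
        rw [hp', LeibnizRing.bracket_zero, map_zero]; rfl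
      · change (⁅p.1, x.1⁆, f p.1 x.1) = 0
        rw [hp', LeibnizRing.zero_bracket, map_zero]; rfl
  have hπ : Function.Surjective π := fun x => ⟨(x, 0), rfl⟩
  let e : Z.Quotient ≃ₗ[K] L :=
    (Submodule.quotEquivOfEq _ _ hZ).trans (π.quotKerEquivOfSurjective hπ)
  have he : ∀ p, e (Z.mkQ p) = p.1 := fun p => rfl
  refine ⟨{ e.symm with map_bracket := fun x y => ?_ }⟩
  change e.symm ⁅x, y⁆ = ⁅e.symm x, e.symm y⁆
  obtain ⟨p, hp⟩ := Z.mk_surjective (e.symm x)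
  obtain ⟨q, hq⟩ := Z.mk_surjective (e.symm y)
  rw [← hp, ← hq, ← LeibnizIdeal.mk_bracket, LinearEquiv.symm_apply_eq, he]
  rw [LinearEquiv.eq_symm_apply, he] at hp hq
  change _ = ⁅p.1, q.1⁆
  rw [hp, hq]

end Cocycle

/-! ### The universal cocycle -/

section UniversalCocycle

open scoped TensorProduct

variable (K L : Type*) [Field K] [LeibnizRing L] [LeibnizAlgebra K L]

/-- The image of the differential `L ⊗ L ⊗ L → L ⊗ L` of the Leibniz complex. -/
def leibnizBoundaries : Submodule K (L ⊗[K] L) :=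
  Submodule.span K
    {t | ∃ x y z : L, t = x ⊗ₜ[K] ⁅y, z⁆ - (⁅x, y⁆ ⊗ₜ[K] z - ⁅x, z⁆ ⊗ₜ[K] y)}

variable {K L}

theorem IsLeibnizCocycle.boundaries_le_ker {A : Type*} [AddCommGroup A] [Module K A]
    {f : L →ₗ[K] L →ₗ[K] A} (hf : IsLeibnizCocycle f) :
    leibnizBoundaries K L ≤ LinearMap.ker (TensorProduct.lift f) := by
  refine Submodule.span_le.mpr ?_
  rintro _ ⟨x, y, z, rfl⟩
  simp [hf x y z]

/-- Universality in the form needed later: every cocycle factors through `L ⊗ L` modulo boundaries,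
so vanishing of the universal one passes to all others. -/
theorem IsLeibnizCocycle.apply_eq_zero {A : Type*} [AddCommGroup A] [Module K A]
    {f : L →ₗ[K] L →ₗ[K] A} (hf : IsLeibnizCocycle f) {x y : L}
    (h : x ⊗ₜ[K] y ∈ leibnizBoundaries K L) : f x y = 0 := by
  simpa using hf.boundaries_le_ker h

variable (K L)

/-- The universal `2`-cocycle of a Leibniz algebra, lifted to a prescribed universe. -/
def universalCocycle : L →ₗ[K] L →ₗ[K] ULift.{w} ((L ⊗[K] L) ⧸ leibnizBoundaries K L) :=
  (TensorProduct.mk K L L).compr₂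
    (ULift.moduleEquiv.symm.toLinearMap ∘ₗ (leibnizBoundaries K L).mkQ)

variable {K L}

theorem universalCocycle_eq_zero {x y : L} (h : universalCocycle.{w} K L x y = 0) :
    x ⊗ₜ[K] y ∈ leibnizBoundaries K L := by
  have h' : (leibnizBoundaries K L).mkQ (x ⊗ₜ[K] y) = 0 := congrArg ULift.down h
  simpa using h'

variable (K L)

theorem universalCocycle_isLeibnizCocycle : IsLeibnizCocycle (universalCocycle.{w} K L) := by
  intro x y z
  apply ULift.down_injective
  change (leibnizBoundaries K L).mkQ (x ⊗ₜ[K] ⁅y, z⁆) =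
    (leibnizBoundaries K L).mkQ (⁅x, y⁆ ⊗ₜ[K] z) - (leibnizBoundaries K L).mkQ (⁅x, z⁆ ⊗ₜ[K] y)
  rw [← map_sub, ← sub_eq_zero, ← map_sub, Submodule.mkQ_apply, Submodule.Quotient.mk_eq_zero]
  exact Submodule.subset_span ⟨x, y, z, rfl⟩

open LeibnizTensor LeibnizExterior

/-- The cocycle `(x, y) ↦ x ⋏₁ y`. -/
def exteriorCocycle : L →ₗ[K] L →ₗ[K]
    LeibnizExterior.Product (LeibnizCrossedModule.id K L) (LeibnizCrossedModule.id K L) :=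
  LinearMap.mk₂ K (fun x y => e₁ _ _ x y)
    (fun x x' y => (congrArg (square _ _).mkQ (mk_eq_of_rel (Rel.add_left₁ x x' y))).trans
      (by rw [map_add, map_add]; rfl))
    (fun k x y => (congrArg (square _ _).mkQ (mk_eq_of_rel (Rel.smul_left₁ k x y))).symm.trans
      (by rw [map_smul, map_smul]; rfl))
    (fun x y y' => (congrArg (square _ _).mkQ (mk_eq_of_rel (Rel.add_right₁ x y y'))).trans
      (by rw [map_add, map_add]; rfl))
    (fun k x y => (congrArg (square _ _).mkQ (mk_eq_of_rel (Rel.smul_right₁ k x y))).symm.trans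
      (by rw [map_smul, map_smul]; rfl))

/-- For the adjoint action, the defining relation `rel3a` is literally the cocycle condition. -/
theorem exteriorCocycle_isLeibnizCocycle : IsLeibnizCocycle (exteriorCocycle K L) :=
  fun x y z => (congrArg (square _ _).mkQ (mk_eq_of_rel (Rel.rel3a x y z))).trans
    (by rw [map_sub, map_sub]; rfl)

variable {L}

/-- The difference is a generator of `square`. Membership of `g` in the exterior center thus means
that `(x, y) ↦ x ⋏₁ y` vanishes whenever one argument is `g`. -/
theorem LeibnizExterior.e₁_eq_e₂ (x y : L) :
    e₁ (LeibnizCrossedModule.id K L) (LeibnizCrossedModule.id K L) x y = e₂ _ _ y x :=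
  (LeibnizIdeal.mk_eq_mk _).mpr (Submodule.subset_span ⟨x, y, x, y, rfl, rfl, rfl⟩)

end UniversalCocycle

/-! ### The two implications between capability and triviality of the exterior center -/

theorem LeibnizAlgebra.zero_mem_exteriorCenter (K L : Type*) [Field K] [LeibnizRing L]
    [LeibnizAlgebra K L] : (0 : L) ∈ LeibnizAlgebra.exteriorCenter K L := by
  intro x
  rw [← LeibnizExterior.e₁_eq_e₂]
  exact ⟨LinearMap.map_zero₂ (exteriorCocycle K L) x, map_zero (exteriorCocycle K L x)⟩

/-- The exterior center of a quotient by the center is trivial. -/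
theorem LeibnizEquiv.eq_zero_of_mem_exteriorCenter {K L Q : Type*} [Field K] [LeibnizRing L]
    [LeibnizAlgebra K L] [LeibnizRing Q] [LeibnizAlgebra K Q]
    (e : LeibnizEquiv K L (LeibnizAlgebra.center K Q).Quotient) {g : L}
    (hg : g ∈ LeibnizAlgebra.exteriorCenter K L) : g = 0 := by
  let Z := LeibnizAlgebra.center K Q
  obtain ⟨e, he⟩ := e
  change ∀ x y, e ⁅x, y⁆ = ⁅e x, e y⁆ at he
  let π : LeibnizHom K Q L :=
    { e.symm.toLinearMap ∘ₗ Z.mkQ with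
      map_bracket := fun x y => by
        change e.symm (Z.mkQ ⁅x, y⁆) = ⁅e.symm (Z.mkQ x), e.symm (Z.mkQ y)⁆
        rw [LinearEquiv.symm_apply_eq, he, e.apply_symm_apply, e.apply_symm_apply,
          LeibnizIdeal.mk_bracket] }
  have hsurj : Function.Surjective π.toLinearMap := e.symm.surjective.comp Z.mk_surjective
  have hker : ∀ a, π.toLinearMap a = 0 ↔ a ∈ Z.toSubmodule := fun a =>
    (map_eq_zero_iff e.symm e.symm.injective).trans (Submodule.Quotient.mk_eq_zero _)
  obtain ⟨ψ, hψ⟩ := LeibnizExterior.exists_lift π hsurj fun a ha => (hker a).mp ha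
  obtain ⟨a, rfl⟩ := hsurj g
  -- Both brackets of `a` with `b` are values of `ψ` at exterior products of `g = π a` with `π b`,
  -- which vanish.
  refine (hker a).mpr fun b => ?_
  rw [← (hψ a b).1, ← (hψ a b).2, (hg _).1, (hg _).2, map_zero]
  exact ⟨rfl, rfl⟩

/-- The extension is built from the universal cocycle rather than from the exterior one because of
universes: `L ⋏ L` lives in `max u v`, whereas `L ⊗ L` lives in `v` and lifts to the `max v w` that
`IsCapable` prescribes. The exterior cocycle serves only to recognise elements of the exterior
center. -/
theorem LeibnizAlgebra.isCapable_of_exteriorCenter_eq (K : Type u) (L : Type v) [Field K]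
    [LeibnizRing L] [LeibnizAlgebra K L] (h : LeibnizAlgebra.exteriorCenter K L = {0}) :
    LeibnizAlgebra.IsCapable.{u, v, w} K L := by
  refine (universalCocycle_isLeibnizCocycle.{w} K L).isCapable fun g hg => ?_
  have hmem : g ∈ LeibnizAlgebra.exteriorCenter K L := by
    intro x
    rw [← LeibnizExterior.e₁_eq_e₂]
    have hc := exteriorCocycle_isLeibnizCocycle K L
    exact ⟨hc.apply_eq_zero (universalCocycle_eq_zero (hg x).2.2.1),
      hc.apply_eq_zero (universalCocycle_eq_zero (hg x).2.2.2)⟩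
  rwa [h] at hmem

end

theorem theorem4p4 (K : Type u) (L : Type v) [Field K] [LeibnizRing L] [LeibnizAlgebra K L] :
    LeibnizAlgebra.IsCapable.{u, v, w} K L ↔ LeibnizAlgebra.exteriorCenter K L = {0} := by
  refine ⟨?_, LeibnizAlgebra.isCapable_of_exteriorCenter_eq.{u, v, w} K L⟩
  rintro ⟨Q, _, _, ⟨e⟩⟩
  refine Set.eq_singleton_iff_unique_mem.mpr ⟨LeibnizAlgebra.zero_mem_exteriorCenter K L, ?_⟩
  exact fun g hg => e.eq_zero_of_mem_exteriorCenter hg
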